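/- Let $A$ be a partially ordered set with a top element $\top$ and a bottom element $\bot$, whose elements are called atoms. The class of games over $A$ is the smallest class that contains $[a]$ for every $a\in A$ (the atomic games) and that contains $\{L\mid R\}$ (a composite game, with left options the elements of $L$ and right options the elements of $R$) for all non-empty sets $L,R$ of games; atomic games have no options. The positions of a game are the game itself, its options, their options, and so on; a game is finite if it has finitely many positions. Define relations $\leq$ and $\triangleleft$ on games by mutual recursion: - $G\leq H$ if and only if $G^L\triangleleft H$ for all left options $G^L$ of $G$, and $G\triangleleft H^R$ for all right options $H^R$ of $H$, and, if $G$ or $H$ is atomic, $G\triangleleft H$; - $G\triangleleft H$ if and only if $G^R\leq H$ for some right option $G^R$ of $G$, or $G\leq H^L$ for some left option $H^L$ of $H$, or $G=[a]$ and $H=[b]$ with $a\leq b$ in $A$. Games $G,H$ are equivalent if $G\leq H$ and $H\leq G$. A game $G$ is passable if each of its positions $K$ is atomic, or has a left option $K^L$ with $K\leq K^L$, or has a right option $K^R$ with $K^R\leq K$. A monotone set coloring game $S$ over $A$ consists of a finite set $|S|$ of cells and a monotone payoff function $\pi_S:\{\bot,\top\}^{|S|}\to A$, where $\bot<\top$ and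 $\{\bot,\top\}^{|S|}$ is ordered pointwise. A position of $S$ is a map $p:|S|\to\{\top,\bot,\star\}$, where $\star$ marks an empty cell. Its game $[\![p]\!]$ over $A$ is $[\pi_S(p)]$ if $p$ has no empty cell, and otherwise it is $\{L\mid R\}$, where $L$ (respectively $R$) is the set of games $[\![q]\!]$ for all positions $q$ obtained from $p$ by coloring exactly one empty cell with $\top$ (respectively with $\bot$). Let $[\![S]\!]=[\![p_0]\!]$, where $p_0$ is the position with all cells empty. **Theorem (realizability theorem for monotone set coloring games).** For every finite passable game $G$ over $A$ there is a monotone set coloring game $S$ over $A$ such that $G$ is equivalent to $[\![S]\!]$. -/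

import Mathlib

universe u v

/-- The class of combinatorial games over a set `A` of atoms: every atom is a game, and nonempty
sets of left and of right options form a composite game.  A set of options is given as a family
indexed by a type; two such presentations give the same game, as sets of options, exactly when
they are related by `CGame.Identical` below. -/
inductive CGame (A : Type u) : Type (max u (v + 1))
  | atom (a : A) : CGame A
  | comp (ι κ : Type v) (hι : Nonempty ι) (hκ : Nonempty κ)
      (L : ι → CGame A) (R : κ → CGame A) : CGame A

namespace CGame

variable {A : Type u}

/-- `G` is of the form `[a]`. -/
def IsAtomic (G : CGame.{u, v} A) : Prop := ∃ a : A, G = atom a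

/-- `K` is a left option of `G`; an atomic game has none. -/
def IsLeftOption (K : CGame.{u, v} A) : CGame.{u, v} A → Prop
  | atom _ => False
  | comp _ _ _ _ L _ => ∃ i, K = L i

/-- `K` is a right option of `G`; an atomic game has none. -/
def IsRightOption (K : CGame.{u, v} A) : CGame.{u, v} A → Prop
  | atom _ => False
  | comp _ _ _ _ _ R => ∃ j, K = R j

/-- `K` is a position of `G`: either `G` itself, or an option of a position of `G`. -/
inductive IsPosition (G : CGame.{u, v} A) : CGame.{u, v} A → Prop
  | refl : IsPosition G G
  | left {H K : CGame.{u, v} A} : IsPosition G H → IsLeftOption K H → IsPosition G K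
  | right {H K : CGame.{u, v} A} : IsPosition G H → IsRightOption K H → IsPosition G K

/-- Two presentations describe the same game: the same atom, or hereditarily the same set of left
options and the same set of right options. -/
def Identical : CGame.{u, v} A → CGame.{u, v} A → Prop
  | atom a, atom b => a = b
  | comp _ _ _ _ L R, comp _ _ _ _ L' R' =>
      ((∀ i, ∃ i', Identical (L i) (L' i')) ∧ (∀ i', ∃ i, Identical (L i) (L' i'))) ∧
      ((∀ j, ∃ j', Identical (R j) (R' j')) ∧ (∀ j', ∃ j, Identical (R j) (R' j')))
  | atom _, comp _ _ _ _ _ _ => False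
  | comp _ _ _ _ _ _, atom _ => False

/-- `G` is finite (short): it has only finitely many distinct positions, where presentations of
the same game are not distinguished. -/
def IsFinite (G : CGame.{u, v} A) : Prop :=
  ∃ s : Set (CGame.{u, v} A), s.Finite ∧ ∀ K, IsPosition G K → ∃ K' ∈ s, Identical K K'

section Order

variable [PartialOrder A]

/- The two order relations.  The defining clauses always refer to smaller pairs of games (the last
clause of `LE` refers to `Tri` of the same pair, which refers to smaller pairs only), so that they
have exactly one solution; see `le_iff` and `tri_iff`. -/
mutual

/-- The relation `G ≤ H` on games. -/
inductive LE : CGame.{u, v} A → CGame.{u, v} A → Prop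
  | intro {G H : CGame.{u, v} A}
      (left : ∀ K, IsLeftOption K G → Tri K H)
      (right : ∀ K, IsRightOption K H → Tri G K)
      (atomic : IsAtomic G ∨ IsAtomic H → Tri G H) : LE G H

/-- The relation `G ⊲ H` on games. -/
inductive Tri : CGame.{u, v} A → CGame.{u, v} A → Prop
  | right {G H K : CGame.{u, v} A} (hK : IsRightOption K G) (h : LE K H) : Tri G H
  | left {G H K : CGame.{u, v} A} (hK : IsLeftOption K H) (h : LE G K) : Tri G H
  | atomic {a b : A} (h : a ≤ b) : Tri (atom a) (atom b)

end

theorem le_iff (G H : CGame.{u, v} A) :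
    LE G H ↔ (∀ K, IsLeftOption K G → Tri K H) ∧ (∀ K, IsRightOption K H → Tri G K) ∧
      (IsAtomic G ∨ IsAtomic H → Tri G H) :=
  ⟨fun ⟨h₁, h₂, h₃⟩ => ⟨h₁, h₂, h₃⟩, fun ⟨h₁, h₂, h₃⟩ => ⟨h₁, h₂, h₃⟩⟩

theorem tri_iff (G H : CGame.{u, v} A) :
    Tri G H ↔ (∃ K, IsRightOption K G ∧ LE K H) ∨ (∃ K, IsLeftOption K H ∧ LE G K) ∨
      (∃ a b : A, G = atom a ∧ H = atom b ∧ a ≤ b) := by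
  constructor
  · rintro (⟨hK, h⟩ | ⟨hK, h⟩ | h)
    · exact Or.inl ⟨_, hK, h⟩
    · exact Or.inr (Or.inl ⟨_, hK, h⟩)
    · exact Or.inr (Or.inr ⟨_, _, rfl, rfl, h⟩)
  · rintro (⟨K, hK, h⟩ | ⟨K, hK, h⟩ | ⟨a, b, rfl, rfl, h⟩)
    · exact Tri.right hK h
    · exact Tri.left hK h
    · exact Tri.atomic h

/-- Equivalence of games: `G ≤ H` and `H ≤ G`. -/
def Equivalent (G H : CGame.{u, v} A) : Prop := LE G H ∧ LE H G

/-- `G` is atomic, or has a left option `K` with `G ≤ K`, or a right option `K` with `K ≤ G`. -/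
def IsLocallyPassable (G : CGame.{u, v} A) : Prop :=
  IsAtomic G ∨ (∃ K, IsLeftOption K G ∧ LE G K) ∨ (∃ K, IsRightOption K G ∧ LE K G)

/-- All positions of `G` are locally passable. -/
def IsPassable (G : CGame.{u, v} A) : Prop := ∀ K, IsPosition G K → IsLocallyPassable K

end Order

end CGame

/-- A monotone set coloring game over `A`: a finite set of cells and a monotone payoff function on
the colorings of the cells by the booleans, ordered pointwise.  Here `true = ⊤` is the color of the
left player and `false = ⊥` the color of the right player. -/
structure MonotoneSetColoringGame (A : Type u) [PartialOrder A] where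
  /-- The set of cells. -/
  carrier : Type v
  /-- There are finitely many cells. -/
  finite_carrier : Finite carrier
  /-- The payoff function. -/
  payoff : (carrier → Bool) →o A

namespace MonotoneSetColoringGame

variable {A : Type u} [PartialOrder A]

/-- A position assigns to each cell a color or `none`, which stands for an empty cell. -/
abbrev Position (S : MonotoneSetColoringGame.{u, v} A) : Type v := S.carrier → Option Bool

/-- The position in which the cell `c` of `p` has been colored with `x`. -/
noncomputable def Position.color {S : MonotoneSetColoringGame.{u, v} A} (p : S.Position)
    (c : S.carrier) (x : Bool) : S.Position :=
  open Classical in Function.update p c (some x)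

theorem Position.ncard_color_lt {S : MonotoneSetColoringGame.{u, v} A} (p : S.Position)
    (c : S.carrier) (hc : p c = none) (x : Bool) :
    {d | p.color c x d = none}.ncard < {d | p d = none}.ncard := by
  classical
  have := S.finite_carrier
  refine Set.ncard_lt_ncard (Set.ssubset_iff_of_subset ?_ |>.2 ⟨c, hc, ?_⟩) (Set.toFinite _)
  · intro d hd
    by_cases h : d = c
    · subst h; exact hc
    · simpa [Position.color, Function.update_of_ne h] using hd
  · simp [Position.color]

open Classical in
/-- The combinatorial game of a position `p`.  If there is an empty cell, then the left (right)
options are the games of the positions obtained by coloring one empty cell with `⊤` (with `⊥`).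
Otherwise it is the atom that the payoff function assigns to the coloring. -/
noncomputable def Position.game {S : MonotoneSetColoringGame.{u, v} A} (p : S.Position) :
    CGame.{u, v} A :=
  if h : Nonempty {c : S.carrier // p c = none} then
    CGame.comp {c : S.carrier // p c = none} {c : S.carrier // p c = none} h h
      (fun c => Position.game (p.color c.1 true))
      (fun c => Position.game (p.color c.1 false))
  else
    CGame.atom (S.payoff fun c => (p c).get
      (Option.isSome_iff_ne_none.2 fun hc => h ⟨⟨c, hc⟩⟩))
termination_by {c | p c = none}.ncard
decreasing_by
  · exact Position.ncard_color_lt p c.1 c.2 true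
  · exact Position.ncard_color_lt p c.1 c.2 false

/-- The combinatorial game of `S` is the game of the initial position, where all cells are
empty. -/
noncomputable def game (S : MonotoneSetColoringGame.{u, v} A) : CGame.{u, v} A :=
  Position.game (S := S) fun _ => none

end MonotoneSetColoringGame

/-- A game is realizable if it is equivalent to the game of a monotone set coloring game. -/
def CGame.IsRealizable {A : Type u} [PartialOrder A] (G : CGame.{u, v} A) : Prop :=
  ∃ S : MonotoneSetColoringGame.{u, v} A, CGame.Equivalent G S.game

/-!
All comparisons are made from the point of view of one of the players `x`. Suppose that `G` is
composite and that `x` has a move that does not hurt. The options of `G` for `x` can be gathered in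
one game `X` by iterated binary choices and threats, those for the opponent in a game `Y`. If `S` is
the threat by `x` to win unless the opponent replies to `X`, then `G` is equivalent to the game in
which `x` may move to `S`, and the opponent may threaten to win unless `x` replies to `S` or `Y`.

So it remains to realize three small templates, with realizable games in the place of their atoms.
With formal labels as atoms, each template is realized by a small board, which is a finite
computation. The games named by the labels are then played side by side with the board, whose final
coloring decides which of them counts. A premature move in the game with label `i` does no harm,
because one can move in the template to a position that is no worse and where `i` does not occur.
-/

namespace CGame

variable {A : Type u}

/-- The options of `G` for a player: the left options for `true`, the right options for `false`. -/
def IsOption : Bool → CGame.{u, v} A → CGame.{u, v} A → Prop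
  | true => IsLeftOption
  | false => IsRightOption

theorem option_induction {P : CGame.{u, v} A → Prop}
    (h : ∀ G, (∀ x K, IsOption x K G → P K) → P G) (G : CGame.{u, v} A) : P G := by
  induction G with
  | atom a => exact h _ fun x _ hK => by cases x <;> exact hK.elim
  | comp ι κ hι hκ L R ihL ihR =>
    refine h _ fun x K hK => ?_
    cases x
    · obtain ⟨j, rfl⟩ := hK
      exact ihR j
    · obtain ⟨i, rfl⟩ := hK
      exact ihL i

theorem not_isOption_atom {x : Bool} {K : CGame.{u, v} A} {a : A} : ¬ IsOption x K (atom a) := by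
  cases x <;> exact id

theorem exists_isOption {G : CGame.{u, v} A} (h : ¬ IsAtomic G) (x : Bool) :
    ∃ K, IsOption x K G := by
  cases G with
  | atom a => exact (h ⟨a, rfl⟩).elim
  | comp ι κ hι hκ L R =>
    cases x
    · exact hκ.elim fun j => ⟨_, j, rfl⟩
    · exact hι.elim fun i => ⟨_, i, rfl⟩

theorem IsOption.not_isAtomic {x : Bool} {G K : CGame.{u, v} A} (h : IsOption x K G) :
    ¬ IsAtomic G := by
  rintro ⟨a, rfl⟩
  exact not_isOption_atom h

theorem IsOption.isPosition {x : Bool} {G K : CGame.{u, v} A} (h : IsOption x K G) :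
    IsPosition G K := by
  cases x
  · exact .right .refl h
  · exact .left .refl h

theorem IsPosition.trans {G H K : CGame.{u, v} A} (h : IsPosition G H) (h' : IsPosition H K) :
    IsPosition G K := by
  induction h' with
  | refl => exact h
  | left _ hK ih => exact ih.left hK
  | right _ hK ih => exact ih.right hK

section Order

variable [PartialOrder A]

/-- `H` is at least as good as `G` for the player `x`: this is `G ≤ H` for the left player
`x = true` and `H ≤ G` for the right player `x = false`. -/
def LEFor : Bool → CGame.{u, v} A → CGame.{u, v} A → Prop
  | true, G, H => LE G H
  | false, G, H => LE H G

/-- The relation `⊲` as seen by the player `x`; compare `CGame.LEFor`. -/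
def TriFor : Bool → CGame.{u, v} A → CGame.{u, v} A → Prop
  | true, G, H => Tri G H
  | false, G, H => Tri H G

variable {x : Bool} {G H K : CGame.{u, v} A}

theorem leFor_not : LEFor (!x) G H ↔ LEFor x H G := by cases x <;> rfl

theorem triFor_not : TriFor (!x) G H ↔ TriFor x H G := by cases x <;> rfl

theorem leFor_iff : LEFor x G H ↔ (∀ K, IsOption x K G → TriFor x K H) ∧
    (∀ K, IsOption (!x) K H → TriFor x G K) ∧ (IsAtomic G ∨ IsAtomic H → TriFor x G H) := by
  cases x
  · exact (le_iff H G).trans ⟨fun ⟨h₁, h₂, h₃⟩ => ⟨h₂, h₁, fun h => h₃ h.symm⟩,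
      fun ⟨h₁, h₂, h₃⟩ => ⟨h₂, h₁, fun h => h₃ h.symm⟩⟩
  · exact le_iff G H

theorem LEFor.tri_of_isOption (h : LEFor x G H) (hK : IsOption x K G) : TriFor x K H :=
  (leFor_iff.1 h).1 K hK

theorem LEFor.tri_of_isOption_not (h : LEFor x G H) (hK : IsOption (!x) K H) : TriFor x G K :=
  (leFor_iff.1 h).2.1 K hK

theorem LEFor.tri_of_isAtomic (h : LEFor x G H) (hA : IsAtomic G ∨ IsAtomic H) : TriFor x G H :=
  (leFor_iff.1 h).2.2 hA

theorem TriFor.of_isOption (hK : IsOption x K H) (h : LEFor x G K) : TriFor x G H := by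
  cases x
  · exact Tri.right hK h
  · exact Tri.left hK h

theorem TriFor.of_isOption_not (hK : IsOption (!x) K G) (h : LEFor x K H) : TriFor x G H := by
  cases x
  · exact Tri.left hK h
  · exact Tri.right hK h

theorem tri_atom_iff {a b : A} : Tri (atom a : CGame.{u, v} A) (atom b) ↔ a ≤ b := by
  refine ⟨?_, .atomic⟩
  rintro (⟨hK, -⟩ | ⟨hK, -⟩ | h)
  exacts [hK.elim, hK.elim, h]

theorem TriFor.trans_atom {a b c : A} (h : TriFor x (atom a : CGame.{u, v} A) (atom b))
    (h' : TriFor x (atom b : CGame.{u, v} A) (atom c)) :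
    TriFor x (atom a : CGame.{u, v} A) (atom c) := by
  cases x
  · exact tri_atom_iff.2 ((tri_atom_iff.1 h').trans (tri_atom_iff.1 h))
  · exact tri_atom_iff.2 ((tri_atom_iff.1 h).trans (tri_atom_iff.1 h'))

theorem leFor_atom_iff {a b : A} : LEFor x (atom a : CGame.{u, v} A) (atom b) ↔
    TriFor x (atom a : CGame.{u, v} A) (atom b) :=
  ⟨fun h => h.tri_of_isAtomic (.inl ⟨a, rfl⟩), fun h => leFor_iff.2
    ⟨fun _ hK => (not_isOption_atom hK).elim, fun _ hK => (not_isOption_atom hK).elim, fun _ => h⟩⟩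

theorem TriFor.cases (h : TriFor x G H) :
    (∃ K, IsOption (!x) K G ∧ LEFor x K H) ∨ (∃ K, IsOption x K H ∧ LEFor x G K) ∨
      ∃ a b, G = atom a ∧ H = atom b := by
  cases x
  · obtain h | h | ⟨a, b, hb, ha, -⟩ := (tri_iff H G).1 h
    exacts [.inr (.inl h), .inl h, .inr (.inr ⟨b, a, ha, hb⟩)]
  · obtain h | h | ⟨a, b, ha, hb, -⟩ := (tri_iff G H).1 h
    exacts [.inl h, .inr (.inl h), .inr (.inr ⟨a, b, ha, hb⟩)]

theorem leFor_refl (x : Bool) (G : CGame.{u, v} A) : LEFor x G G := by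
  induction G using option_induction with
  | h G ih =>
    refine leFor_iff.2 ⟨fun K hK => .of_isOption hK (ih x K hK),
      fun K hK => .of_isOption_not hK (ih (!x) K hK), ?_⟩
    rintro (⟨a, rfl⟩ | ⟨a, rfl⟩) <;> cases x <;> exact Tri.atomic le_rfl

theorem triFor_of_isOption (h : IsOption x K G) : TriFor x K G := .of_isOption h (leFor_refl x K)

theorem triFor_and_leFor_trans (x : Bool) (G H K : CGame.{u, v} A) :
    (TriFor x G H → LEFor x H K → TriFor x G K) ∧ (LEFor x G H → TriFor x H K → TriFor x G K) ∧
      (LEFor x G H → LEFor x H K → LEFor x G K) := by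
  induction G using option_induction generalizing H K with
  | h G ihG =>
  induction H using option_induction generalizing K with
  | h H ihH =>
  induction K using option_induction with
  | h K ihK =>
  have h₁ : TriFor x G H → LEFor x H K → TriFor x G K := by
    intro hGH hHK
    obtain ⟨G', hG', h⟩ | ⟨H', hH', h⟩ | ⟨a, b, rfl, rfl⟩ := hGH.cases
    · exact .of_isOption_not hG' ((ihG _ G' hG' H K).2.2 h hHK)
    · exact (ihH _ H' hH' K).2.1 h (hHK.tri_of_isOption hH')
    · have hbK := hHK.tri_of_isAtomic (.inl ⟨b, rfl⟩)
      obtain ⟨H', hH', -⟩ | ⟨K', hK', h⟩ | ⟨-, c, -, rfl⟩ := hbK.cases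
      · exact (not_isOption_atom hH').elim
      · exact .of_isOption hK' ((ihK _ K' hK').2.2 (leFor_atom_iff.2 hGH) h)
      · exact hGH.trans_atom hbK
  have h₂ : LEFor x G H → TriFor x H K → TriFor x G K := by
    intro hGH hHK
    obtain ⟨H', hH', h⟩ | ⟨K', hK', h⟩ | ⟨b, c, rfl, rfl⟩ := hHK.cases
    · exact (ihH _ H' hH' K).1 (hGH.tri_of_isOption_not hH') h
    · exact .of_isOption hK' ((ihK _ K' hK').2.2 hGH h)
    · have hGb := hGH.tri_of_isAtomic (.inr ⟨b, rfl⟩)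
      obtain ⟨G', hG', h⟩ | ⟨H', hH', -⟩ | ⟨a, -, rfl, -⟩ := hGb.cases
      · exact .of_isOption_not hG' ((ihG _ G' hG' _ _).2.2 h (leFor_atom_iff.2 hHK))
      · exact (not_isOption_atom hH').elim
      · exact hGb.trans_atom hHK
  refine ⟨h₁, h₂, fun hGH hHK => leFor_iff.2 ⟨?_, ?_, ?_⟩⟩
  · exact fun G' hG' => (ihG _ G' hG' H K).1 (hGH.tri_of_isOption hG') hHK
  · exact fun K' hK' => (ihK _ K' hK').2.1 hGH (hHK.tri_of_isOption_not hK')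
  · rintro (h | h)
    · exact h₁ (hGH.tri_of_isAtomic (.inl h)) hHK
    · exact h₂ hGH (hHK.tri_of_isAtomic (.inr h))

theorem LEFor.trans (h : LEFor x G H) (h' : LEFor x H K) : LEFor x G K :=
  (triFor_and_leFor_trans x G H K).2.2 h h'

theorem LEFor.trans_tri (h : LEFor x G H) (h' : TriFor x H K) : TriFor x G K :=
  (triFor_and_leFor_trans x G H K).2.1 h h'

theorem TriFor.trans_le (h : TriFor x G H) (h' : LEFor x H K) : TriFor x G K :=
  (triFor_and_leFor_trans x G H K).1 h h'

theorem Equivalent.leFor (h : Equivalent G H) (x : Bool) : LEFor x G H := by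
  cases x
  exacts [h.2, h.1]

theorem equivalent_of_leFor (h : ∀ x, LEFor x G H) : Equivalent G H := ⟨h true, h false⟩

theorem LEFor.equivalent (h : LEFor x G H) (h' : LEFor x H G) : Equivalent G H := by
  cases x
  exacts [⟨h', h⟩, ⟨h, h'⟩]

theorem Equivalent.symm (h : Equivalent G H) : Equivalent H G := ⟨h.2, h.1⟩

theorem Equivalent.trans (h : Equivalent G H) (h' : Equivalent H K) : Equivalent G K :=
  equivalent_of_leFor fun x => (h.leFor x).trans (h'.leFor x)

end Order

section Identical

variable {G H K : CGame.{u, v} A}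

theorem Identical.symm (h : Identical G H) : Identical H G := by
  induction G generalizing H with
  | atom a =>
    cases H <;> simp only [Identical] at h ⊢
    exact h.symm
  | comp ι κ hι hκ L R ihL ihR =>
    cases H <;> simp only [Identical] at h ⊢
    obtain ⟨⟨hL, hL'⟩, hR, hR'⟩ := h
    exact ⟨⟨fun i => (hL' i).imp fun j => ihL j, fun i => (hL i).imp fun _ => ihL i⟩,
      fun i => (hR' i).imp fun j => ihR j, fun i => (hR i).imp fun _ => ihR i⟩

theorem Identical.exists_isOption {x : Bool} (h : Identical G H) (hK : IsOption x K G) :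
    ∃ K', IsOption x K' H ∧ Identical K K' := by
  cases G with
  | atom a => exact (not_isOption_atom hK).elim
  | comp ι κ hι hκ L R =>
    cases H <;> simp only [Identical] at h
    cases x <;> obtain ⟨i, rfl⟩ := hK
    · exact (h.2.1 i).elim fun j hj => ⟨_, ⟨j, rfl⟩, hj⟩
    · exact (h.1.1 i).elim fun j hj => ⟨_, ⟨j, rfl⟩, hj⟩

theorem Identical.eq_of_isAtomic (h : Identical G H) (hG : IsAtomic G) : G = H := by
  obtain ⟨a, rfl⟩ := hG
  cases H <;> simp only [Identical] at h
  rw [h]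

theorem Identical.leFor [PartialOrder A] (h : Identical G H) (x : Bool) : LEFor x G H := by
  induction G using option_induction generalizing H with
  | h G ih =>
    refine leFor_iff.2 ⟨fun K hK => ?_, fun K hK => ?_, fun hA => ?_⟩
    · obtain ⟨K', hK', hKK'⟩ := h.exists_isOption hK
      exact .of_isOption hK' (ih x K hK hKK')
    · obtain ⟨K', hK', hKK'⟩ := h.symm.exists_isOption hK
      exact .of_isOption_not hK' (ih (!x) K' hK' hKK'.symm)
    · have hGH : G = H := hA.elim h.eq_of_isAtomic fun hH => (h.symm.eq_of_isAtomic hH).symm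
      exact hGH ▸ (leFor_refl x G).tri_of_isAtomic (hGH ▸ hA)

theorem Identical.equivalent [PartialOrder A] (h : Identical G H) : Equivalent G H :=
  equivalent_of_leFor h.leFor

end Identical

section BoundedOrder

variable [PartialOrder A] [BoundedOrder A]

/-- The best atom for the player `x`; the worst one is `best (!x)`. -/
def best : Bool → A
  | true => ⊤
  | false => ⊥

theorem leFor_atom_best (x : Bool) (G : CGame.{u, v} A) : LEFor x G (atom (best x)) := by
  suffices h : TriFor x G (atom (best x)) ∧ LEFor x G (atom (best x)) from h.2
  induction G using option_induction with
  | h G ih =>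
    have tri : TriFor x G (atom (best x)) := by
      by_cases hG : IsAtomic G
      · obtain ⟨a, rfl⟩ := hG
        cases x
        exacts [.atomic bot_le, .atomic le_top]
      · obtain ⟨K, hK⟩ := exists_isOption hG (!x)
        exact .of_isOption_not hK (ih _ K hK).2
    exact ⟨tri, leFor_iff.2
      ⟨fun K hK => (ih x K hK).1, fun _ hK => (not_isOption_atom hK).elim, fun _ => tri⟩⟩

theorem leFor_atom_best_not (x : Bool) (G : CGame.{u, v} A) : LEFor x (atom (best !x)) G :=
  leFor_not.1 (leFor_atom_best (!x) G)

end BoundedOrder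

end CGame

namespace MonotoneSetColoringGame

open CGame

variable {A : Type u} [PartialOrder A] {S T : MonotoneSetColoringGame.{u, v} A}

namespace Position

theorem color_same (p : S.Position) (c : S.carrier) (x : Bool) : p.color c x c = some x := by
  simp [color]

theorem color_of_ne (p : S.Position) {c d : S.carrier} (h : d ≠ c) (x : Bool) :
    p.color c x d = p d := by
  simp [color, h]

theorem color_induction {P : S.Position → Prop}
    (h : ∀ p : S.Position, (∀ c x, p c = none → P (p.color c x)) → P p) (p : S.Position) : P p := by
  induction hn : {c | p c = none}.ncard using Nat.strong_induction_on generalizing p with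
  | _ n ih =>
    subst hn
    exact h p fun c x hc => ih _ (p.ncard_color_lt c hc x) _ rfl

theorem isOption_game_iff {p : S.Position} {x : Bool} {K : CGame.{u, v} A} :
    IsOption x K p.game ↔ ∃ c, p c = none ∧ K = (p.color c x).game := by
  rw [game]
  split_ifs with h
  · cases x <;>
      exact ⟨fun ⟨⟨c, hc⟩, hK⟩ => ⟨c, hc, hK⟩, fun ⟨c, hc, hK⟩ => ⟨⟨c, hc⟩, hK⟩⟩
  · exact iff_of_false not_isOption_atom fun ⟨c, hc, _⟩ => h ⟨⟨c, hc⟩⟩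

theorem isOption_color {p : S.Position} {c : S.carrier} (hc : p c = none) (x : Bool) :
    IsOption x (p.color c x).game p.game := isOption_game_iff.2 ⟨c, hc, rfl⟩

theorem game_some (w : S.carrier → Bool) :
    game (S := S) (fun c => some (w c)) = atom (S.payoff w) := by
  rw [game, dif_neg (by rintro ⟨c, hc⟩; cases hc)]
  rfl

theorem exists_eq_none_or_eq_some (p : S.Position) :
    (∃ c, p c = none) ∨ ∃ w : S.carrier → Bool, p = fun c => some (w c) := by
  refine or_iff_not_imp_left.2 fun h => ?_
  push Not at h
  choose w hw using fun c => Option.ne_none_iff_exists'.1 (h c)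
  exact ⟨w, funext hw⟩

/-- `w` is a coloring of all cells that extends the partial coloring `p`. -/
def IsCompletion (p : S.Position) (w : S.carrier → Bool) : Prop := ∀ c x, p c = some x → w c = x

theorem IsCompletion.of_color {p : S.Position} {c : S.carrier} {x : Bool} {w : S.carrier → Bool}
    (h : (p.color c x).IsCompletion w) (hc : p c = none) : p.IsCompletion w := by
  intro d y hd
  have hdc : d ≠ c := by
    rintro rfl
    simp [hc] at hd
  exact h d y (by rwa [color_of_ne p hdc])

/-- The cells of `S` and `T` are partially matched by `M` in such a way that the left player is at
least as well off in `q` as in `p`: an empty cell ranks between the two colors on matched cells,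
and the colors of unmatched cells do not affect the comparison of the payoffs. -/
structure DominatedBy (M : S.carrier → T.carrier → Prop) (p : S.Position) (q : T.Position) :
    Prop where
  eq_true : ∀ c d, M c d → p c = some true → q d = some true
  eq_false : ∀ c d, M c d → q d = some false → p c = some false
  payoff_le : ∀ w w', p.IsCompletion w → q.IsCompletion w' → (∀ c d, M c d → w c ≤ w' d) →
    S.payoff w ≤ T.payoff w'

namespace DominatedBy

variable {M : S.carrier → T.carrier → Prop} {p : S.Position} {q : T.Position} {c : S.carrier}
  {d : T.carrier}

theorem color_left (h : DominatedBy M p q) (hc : p c = none) {x : Bool}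
    (hx : x = true → ∀ d, M c d → q d = some true) : DominatedBy M (p.color c x) q where
  eq_true := by
    intro c' d hM hc'
    by_cases e : c' = c
    · subst e
      rw [color_same, Option.some.injEq] at hc'
      exact hx hc' d hM
    · exact h.eq_true c' d hM (by rwa [color_of_ne p e] at hc')
  eq_false := by
    intro c' d hM hd
    have := h.eq_false c' d hM hd
    rwa [color_of_ne p (by rintro rfl; simp [hc] at this)]
  payoff_le := fun w w' hw hw' => h.payoff_le w w' (hw.of_color hc) hw'

theorem color_right (h : DominatedBy M p q) (hd : q d = none) {x : Bool}
    (hx : x = false → ∀ c, M c d → p c = some false) : DominatedBy M p (q.color d x) where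
  eq_true := by
    intro c d' hM hc
    have := h.eq_true c d' hM hc
    rwa [color_of_ne q (by rintro rfl; simp [hd] at this)]
  eq_false := by
    intro c d' hM hd'
    by_cases e : d' = d
    · subst e
      rw [color_same, Option.some.injEq] at hd'
      exact hx hd' c hM
    · exact h.eq_false c d' hM (by rwa [color_of_ne q e] at hd')
  payoff_le := fun w w' hw hw' => h.payoff_le w w' hw (hw'.of_color hd)

theorem color_both (hM : Relator.BiUnique M) (h : DominatedBy M p q) (hcd : M c d) (hc : p c = none)
    (hd : q d = none) (x : Bool) : DominatedBy M (p.color c x) (q.color d x) := by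
  have key {c' d'} (hM' : M c' d') : c' = c ∧ d' = d ∨ c' ≠ c ∧ d' ≠ d := by
    by_cases e : c' = c
    · exact .inl ⟨e, hM.2 (e ▸ hM') hcd⟩
    · exact .inr ⟨e, fun e' => e (hM.1 (e' ▸ hM') hcd)⟩
  refine ⟨fun c' d' hM' => ?_, fun c' d' hM' => ?_,
    fun w w' hw hw' => h.payoff_le w w' (hw.of_color hc) (hw'.of_color hd)⟩
  all_goals
    obtain ⟨rfl, rfl⟩ | ⟨hc', hd'⟩ := key hM'
    · simp only [color_same, imp_self]
    · rw [color_of_ne p hc', color_of_ne q hd']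
      first | exact h.eq_true c' d' hM' | exact h.eq_false c' d' hM'

/-- The player who profits from the comparison imitates each move in the matched cell, or plays
anywhere if this is not possible. -/
theorem le_and_tri (hM : Relator.BiUnique M) (h : DominatedBy M p q) :
    LE p.game q.game ∧ Tri p.game q.game := by
  induction p using color_induction generalizing q with
  | h p ihp =>
  induction q using color_induction with
  | h q ihq =>
  have tri : Tri p.game q.game := by
    obtain ⟨c, hc⟩ | ⟨w, rfl⟩ := p.exists_eq_none_or_eq_some
    · exact .right (isOption_color hc false) (ihp c false hc (h.color_left hc (by simp))).1
    obtain ⟨d, hd⟩ | ⟨w', rfl⟩ := q.exists_eq_none_or_eq_some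
    · exact .left (isOption_color hd true) (ihq d true hd (h.color_right hd (by simp))).1
    rw [game_some, game_some, tri_atom_iff]
    refine h.payoff_le w w' (fun c x hc => Option.some.inj hc) (fun d x hd => Option.some.inj hd)
      fun c d hcd => Bool.le_iff_imp.2 fun hc => ?_
    exact Option.some.inj (h.eq_true c d hcd (congrArg some hc))
  refine ⟨LE.intro (fun K hK => ?_) (fun K hK => ?_) fun _ => tri, tri⟩
  · obtain ⟨c, hc, rfl⟩ := isOption_game_iff (x := true).1 hK
    by_cases hd : ∃ d, M c d ∧ q d = none
    · obtain ⟨d, hcd, hd⟩ := hd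
      exact .left (isOption_color hd true) (ihp c true hc (h.color_both hM hcd hc hd true)).1
    · refine (ihp c true hc (h.color_left hc fun _ d hcd => ?_)).2
      have := h.eq_false c d hcd
      rcases hqd : q d with - | - | - <;> simp_all
  · obtain ⟨d, hd, rfl⟩ := isOption_game_iff (x := false).1 hK
    by_cases hc : ∃ c, M c d ∧ p c = none
    · obtain ⟨c, hcd, hc⟩ := hc
      exact .right (isOption_color hc false) (ihp c false hc (h.color_both hM hcd hc hd false)).1
    · refine (ihq d false hd (h.color_right hd fun _ c hcd => ?_)).2
      have := h.eq_true c d hcd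
      rcases hpc : p c with - | - | - <;> simp_all

end DominatedBy

theorem leFor_color {p : S.Position} {c : S.carrier} (hc : p c = none) (x : Bool) :
    LEFor x p.game (p.color c x).game := by
  have hM : Relator.BiUnique (Eq : S.carrier → S.carrier → Prop) := by
    constructor <;> rintro a b c rfl rfl <;> rfl
  have hp : DominatedBy Eq p p :=
    ⟨by rintro c _ rfl h; exact h, by rintro c _ rfl h; exact h,
      fun w w' _ _ h => S.payoff.monotone fun c => h c c rfl⟩
  cases x
  · exact ((hp.color_left hc (by simp)).le_and_tri hM).1
  · exact ((hp.color_right hc (by simp)).le_and_tri hM).1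

theorem triFor_game_of_leFor {x : Bool} {p : S.Position} {K : CGame.{u, v} A}
    (h : LEFor x K p.game) : TriFor x K p.game := by
  obtain ⟨c, hc⟩ | ⟨w, rfl⟩ := p.exists_eq_none_or_eq_some
  · exact .of_isOption (isOption_color hc x) (h.trans (leFor_color hc x))
  · exact h.tri_of_isAtomic (.inr ⟨_, game_some w⟩)

theorem triFor_of_game_leFor {x : Bool} {p : S.Position} {K : CGame.{u, v} A}
    (h : LEFor x p.game K) : TriFor x p.game K := by
  rw [← leFor_not] at h
  rw [← triFor_not]
  exact triFor_game_of_leFor h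

end Position

end MonotoneSetColoringGame

/-- The possible results of a play on a board with exits to `k` further games: the right player wins
at once, the left player wins at once, or the result of the `i`-th of the further games counts. -/
inductive Outcome (k : ℕ) : Type u
  | bot
  | top
  | label (i : Fin k)
  deriving DecidableEq

namespace Outcome

variable {k : ℕ}

/-- The value that an outcome stands for, when the values of `⊥`, `⊤` and of the labels are
given. -/
def elim {α : Sort*} (b t : α) (f : Fin k → α) : Outcome.{u} k → α
  | bot => b
  | top => t
  | label i => f i

/-- The flat order: distinct labels are incomparable. -/
instance : PartialOrder (Outcome.{u} k) where
  le o o' := o = bot ∨ o' = top ∨ o = o'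
  le_refl _ := .inr (.inr rfl)
  le_trans _ _ _ := by
    rintro (rfl | rfl | rfl) (h | rfl | rfl) <;> simp_all
  le_antisymm _ _ := by
    rintro (rfl | rfl | rfl) (h | h | h) <;> simp_all

theorem le_def {o o' : Outcome.{u} k} : o ≤ o' ↔ o = bot ∨ o' = top ∨ o = o' := Iff.rfl

instance : DecidableLE (Outcome.{u} k) := fun o o' =>
  inferInstanceAs (Decidable (o = bot ∨ o' = top ∨ o = o'))

instance : BoundedOrder (Outcome.{u} k) where
  bot := bot
  bot_le _ := .inl rfl
  top := top
  le_top _ := .inr (.inl rfl)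

theorem elim_mono {A : Type*} [PartialOrder A] [BoundedOrder A] {o o' : Outcome.{u} k}
    {a a' : Fin k → A} (h : o ≤ o') (ha : a ≤ a') : o.elim ⊥ ⊤ a ≤ o'.elim ⊥ ⊤ a' := by
  obtain rfl | rfl | rfl := h
  · exact bot_le
  · exact le_top
  · cases o
    exacts [le_rfl, le_rfl, ha _]

end Outcome

namespace MonotoneSetColoringGame

open CGame

variable {A : Type u} [PartialOrder A] {S T : MonotoneSetColoringGame.{u, v} A}

theorem Position.equivalent_of_payoff_eq {p : S.Position} {q : T.Position}
    {f : T.carrier → S.carrier} (hf : f.Injective) (hpq : q = p ∘ f)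
    (h : ∀ w, p.IsCompletion w → S.payoff w = T.payoff (w ∘ f)) :
    Equivalent p.game q.game := by
  subst hpq
  have hM : Relator.BiUnique fun c d => c = f d := by
    constructor
    · rintro c d c' rfl rfl; rfl
    · rintro c d d' rfl hd; exact hf hd
  constructor
  · refine (DominatedBy.le_and_tri (M := fun c d => c = f d) hM ⟨?_, ?_, ?_⟩).1
    · rintro _ d rfl hd; exact hd
    · rintro _ d rfl hd; exact hd
    · exact fun w w' hw _ hww' => (h w hw).trans_le (T.payoff.monotone fun d => hww' _ d rfl)
  · refine (DominatedBy.le_and_tri (M := fun d c => c = f d)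
      ⟨fun _ _ _ h h' => hM.2 h h', fun _ _ _ h h' => hM.1 h h'⟩ ⟨?_, ?_, ?_⟩).1
    · rintro d _ rfl hd; exact hd
    · rintro d _ rfl hd; exact hd
    · exact fun w w' _ hw' hww' =>
        (T.payoff.monotone fun d => hww' d _ rfl).trans_eq (h w' hw').symm

/-- The game without cells and with payoff `a`. -/
@[reducible] def constant (a : A) : MonotoneSetColoringGame.{u, v} A where
  carrier := PEmpty
  finite_carrier := inferInstance
  payoff := OrderHom.const _ a

theorem game_constant (a : A) (p : (constant.{u, v} a).Position) : p.game = atom a := by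
  have hp : p = fun c => some (PEmpty.elim c) := funext fun c => PEmpty.elim c
  rw [hp, Position.game_some]
  rfl

section Compound

variable [BoundedOrder A] {k : ℕ}

/-- The board `B` and the games `S i` are played side by side. At the end, the result on the
board either decides the play or names the game whose payoff counts. -/
@[reducible] def compound (B : MonotoneSetColoringGame.{u, v} (Outcome.{u} k))
    (S : Fin k → MonotoneSetColoringGame.{u, v} A) : MonotoneSetColoringGame.{u, v} A where
  carrier := B.carrier ⊕ Σ i, (S i).carrier
  finite_carrier := by
    have := B.finite_carrier
    have := fun i => (S i).finite_carrier
    infer_instance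
  payoff := {
    toFun w := (B.payoff fun c => w (.inl c)).elim ⊥ ⊤
      fun i => (S i).payoff fun c => w (.inr ⟨i, c⟩)
    monotone' _ _ h := Outcome.elim_mono (B.payoff.monotone fun _ => h _)
      fun i => (S i).payoff.monotone fun _ => h _ }

variable {B : MonotoneSetColoringGame.{u, v} (Outcome.{u} k)}
  {S : Fin k → MonotoneSetColoringGame.{u, v} A}

namespace compound

/-- The position on the board of a compound. -/
def board (q : (compound B S).Position) : B.Position := fun c => q (.inl c)

/-- The position in the `i`-th component of a compound. -/
def part (q : (compound B S).Position) (i : Fin k) : (S i).Position := fun c => q (.inr ⟨i, c⟩)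

variable (q : (compound B S).Position) (x : Bool) (i : Fin k)

theorem board_color_inl (c : B.carrier) :
    board (q.color (.inl c) x) = (board q).color c x := by
  funext d
  by_cases h : d = c
  · subst h; simp [board, Position.color]
  · simp [board, Position.color, h]

theorem part_color_inl (c : B.carrier) : part (q.color (.inl c) x) i = part q i := by
  funext d
  simp [part, Position.color]

theorem board_color_inr (c : Σ i, (S i).carrier) : board (q.color (.inr c) x) = board q := by
  funext d
  simp [board, Position.color]

theorem part_color_inr_same (c : (S i).carrier) :
    part (q.color (.inr ⟨i, c⟩) x) i = (part q i).color c x := by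
  funext d
  by_cases h : d = c
  · subst h; simp [part, Position.color]
  · simp [part, Position.color, h]

theorem part_color_inr_of_ne {i j : Fin k} (h : j ≠ i) (c : (S i).carrier) :
    part (q.color (.inr ⟨i, c⟩) x) j = part q j := by
  funext d
  simp [part, Position.color, h]

theorem equivalent_of_board_eq_some {q : (compound B S).Position} {w : B.carrier → Bool}
    (hw : board q = fun c => some (w c)) :
    Equivalent q.game ((B.payoff w).elim (atom ⊥) (atom ⊤) fun i => (part q i).game) := by
  have hpay {w' : (compound B S).carrier → Bool} (hw' : q.IsCompletion w') :
      (compound B S).payoff w' =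
        (B.payoff w).elim ⊥ ⊤ fun i => (S i).payoff fun c => w' (.inr ⟨i, c⟩) := by
    have : (fun c => w' (.inl c)) = w := funext fun c => hw' (.inl c) _ (congrFun hw c)
    rw [← this]
    rfl
  have decided {a : A} (ha : ∀ w', q.IsCompletion w' → (compound B S).payoff w' = a) :
      Equivalent q.game (atom a) := by
    rw [← game_constant a fun c => c.elim]
    exact Position.equivalent_of_payoff_eq (f := PEmpty.elim) (fun c => c.elim)
      (funext fun c => c.elim) ha
  cases ho : B.payoff w with
  | bot => exact decided fun w' hw' => by rw [hpay hw', ho]; rfl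
  | top => exact decided fun w' hw' => by rw [hpay hw', ho]; rfl
  | label i =>
    exact Position.equivalent_of_payoff_eq (f := fun c => .inr ⟨i, c⟩)
      (fun c d h => by simpa using h) rfl fun w' hw' => by rw [hpay hw', ho]; rfl

end compound

end Compound

end MonotoneSetColoringGame

/-- A game in which the atoms are outcomes, hence may be labels that are to be replaced by games;
its sets of options are finite. -/
inductive Template (k : ℕ) : Type u
  | atom (o : Outcome.{u} k)
  | comp (m n : ℕ) (L : Fin (m + 1) → Template k) (R : Fin (n + 1) → Template k)

namespace Template

open CGame

variable {k : ℕ} {A : Type u} [PartialOrder A] [BoundedOrder A]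

/-- The options of a template for a player. -/
def options : Bool → Template.{u} k → List (Template.{u} k)
  | _, atom _ => []
  | true, comp _ _ L _ => List.ofFn L
  | false, comp _ _ _ R => List.ofFn R

/-- The game obtained from a template by replacing the labels by the games `σ i`. -/
def inst (σ : Fin k → CGame.{u, v} A) : Template.{u} k → CGame.{u, v} A
  | atom o => o.elim (.atom ⊥) (.atom ⊤) σ
  | comp m n L R => .comp (ULift (Fin (m + 1))) (ULift (Fin (n + 1))) ⟨⟨0⟩⟩ ⟨⟨0⟩⟩
      (fun i => (L i.down).inst σ) (fun j => (R j.down).inst σ)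

/-- The template itself, viewed as a game with outcomes as atoms. -/
def toGame (H : Template.{u} k) : CGame.{u, v} (Outcome.{u} k) :=
  H.inst fun i => .atom (.label i)

theorem toGame_atom (o : Outcome.{u} k) : (atom o).toGame = CGame.atom.{u, v} o := by
  cases o <;> rfl

theorem isOption_inst_of_mem {x : Bool} {H K : Template.{u} k} (h : K ∈ H.options x)
    (σ : Fin k → CGame.{u, v} A) : IsOption x (K.inst σ) (H.inst σ) := by
  cases H with
  | atom o => cases x <;> cases h
  | comp m n L R =>
    cases x <;> obtain ⟨i, rfl⟩ := List.mem_ofFn.1 h <;> exact ⟨⟨i⟩, rfl⟩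

theorem exists_mem_options {x : Bool} {m n : ℕ} {L : Fin (m + 1) → Template.{u} k}
    {R : Fin (n + 1) → Template.{u} k} {σ : Fin k → CGame.{u, v} A} {K : CGame.{u, v} A}
    (h : IsOption x K ((comp m n L R).inst σ)) :
    ∃ K' ∈ (comp m n L R).options x, K = K'.inst σ := by
  cases x <;> obtain ⟨⟨i⟩, rfl⟩ := h <;> exact ⟨_, List.mem_ofFn.2 ⟨i, rfl⟩, rfl⟩

theorem not_isAtomic_inst_comp {m n : ℕ} {L : Fin (m + 1) → Template.{u} k}
    {R : Fin (n + 1) → Template.{u} k} (σ : Fin k → CGame.{u, v} A) :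
    ¬ IsAtomic ((comp m n L R).inst σ) :=
  (isOption_inst_of_mem (x := true) (List.mem_ofFn.2 ⟨0, rfl⟩) σ).not_isAtomic

theorem leFor_inst_atom {x : Bool} {o o' : Outcome.{u} k}
    (h : TriFor x (CGame.atom.{u, v} o) (CGame.atom o')) (σ : Fin k → CGame.{u, v} A) :
    LEFor x ((atom o).inst σ) ((atom o').inst σ) := by
  have key {o o' : Outcome.{u} k} (h : o ≤ o') : LE ((atom o).inst σ) ((atom o').inst σ) := by
    obtain rfl | rfl | rfl := h
    · exact leFor_atom_best_not true _
    · exact leFor_atom_best true _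
    · exact leFor_refl true _
  cases x
  exacts [key (tri_atom_iff.1 h), key (tri_atom_iff.1 h)]

theorem inst_mono {x : Bool} {σ τ : Fin k → CGame.{u, v} A} (h : ∀ i, LEFor x (σ i) (τ i))
    (H : Template.{u} k) : LEFor x (H.inst σ) (H.inst τ) := by
  have options {m n : ℕ} {L : Fin (m + 1) → Template.{u} k} {R : Fin (n + 1) → Template.{u} k}
      (ihL : ∀ i, LEFor x ((L i).inst σ) ((L i).inst τ))
      (ihR : ∀ i, LEFor x ((R i).inst σ) ((R i).inst τ)) (y : Bool) :
      ∀ K ∈ (comp m n L R).options y, LEFor x (K.inst σ) (K.inst τ) := by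
    cases y <;> intro K hK <;> obtain ⟨i, rfl⟩ := List.mem_ofFn.1 hK
    exacts [ihR i, ihL i]
  induction H with
  | atom o =>
    cases o with
    | label i => exact h i
    | _ => exact leFor_refl x _
  | comp m n L R ihL ihR =>
    refine leFor_iff.2 ⟨fun K hK => ?_, fun K hK => ?_,
      fun hA => (hA.elim (not_isAtomic_inst_comp σ) (not_isAtomic_inst_comp τ)).elim⟩
    · obtain ⟨K, hK', rfl⟩ := exists_mem_options hK
      exact .of_isOption (isOption_inst_of_mem hK' τ) (options ihL ihR _ K hK')
    · obtain ⟨K, hK', rfl⟩ := exists_mem_options hK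
      exact .of_isOption_not (isOption_inst_of_mem hK' σ) (options ihL ihR _ K hK')

/-- The label `i` does not occur in the template. -/
def Avoids (i : Fin k) : Template.{u} k → Prop
  | atom o => o ≠ .label i
  | comp _ _ L R => (∀ j, (L j).Avoids i) ∧ ∀ j, (R j).Avoids i

theorem Avoids.inst_eq {i : Fin k} {H : Template.{u} k} (h : H.Avoids i)
    {σ τ : Fin k → CGame.{u, v} A} (hστ : ∀ j ≠ i, σ j = τ j) : H.inst σ = H.inst τ := by
  induction H with
  | atom o =>
    cases o with
    | label j => exact hστ j fun hj => h (hj ▸ rfl)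
    | _ => rfl
  | comp m n L R ihL ihR =>
    simp only [inst]
    congr 1 <;> funext j
    exacts [ihL _ (h.1 _), ihR _ (h.2 _)]

/-- Every composite position of the template is passable in a uniform way, and moreover, for each
label `i`, by a move to a position where `i` no longer occurs. -/
inductive Insulated : Template.{u} k → Prop
  | atom (o : Outcome.{u} k) : Insulated (atom o)
  | comp {m n : ℕ} {L : Fin (m + 1) → Template k} {R : Fin (n + 1) → Template k}
      (options : ∀ x, ∀ K ∈ (comp m n L R).options x, Insulated K)
      (escape : ∀ i, ∃ x, ∃ K ∈ (comp m n L R).options x, K.Avoids i ∧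
        ∀ (A : Type u) [PartialOrder A] [BoundedOrder A] (σ : Fin k → CGame.{u, v} A),
          LEFor x ((comp m n L R).inst σ) (K.inst σ)) :
      Insulated (comp m n L R)

end Template

namespace MonotoneSetColoringGame.compound

open CGame

variable {k : ℕ} {A : Type u} [PartialOrder A] [BoundedOrder A]
  {B : MonotoneSetColoringGame.{u, v} (Outcome.{u} k)}
  {S : Fin k → MonotoneSetColoringGame.{u, v} A}

/-- The template `H`, with the games of the component positions of `q` for the labels. -/
noncomputable def instAt (q : (compound B S).Position) (H : Template.{u} k) : CGame.{u, v} A :=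
  H.inst fun i => (part q i).game

/-- If the player `x` prefers `H` to the board, then this remains so if the components of `q` are
played along with the board and inserted in `H`. -/
def Preserves (x : Bool) (H : Template.{u} k) (q : (compound B S).Position) : Prop :=
  (LEFor x (board q).game H.toGame → LEFor x q.game (instAt q H)) ∧
    (TriFor x (board q).game H.toGame → TriFor x q.game (instAt q H))

variable {x : Bool} {H : Template.{u} k} {q : (compound B S).Position}

theorem instAt_color_inl (c : B.carrier) (H : Template.{u} k) :
    instAt (q.color (.inl c) x) H = instAt q H := by
  simp only [instAt, part_color_inl]

theorem instAt_color_inr {i : Fin k} (hH : H.Avoids i) (c : (S i).carrier) :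
    instAt (q.color (.inr ⟨i, c⟩) x) H = instAt q H :=
  hH.inst_eq fun j hj => by rw [part_color_inr_of_ne q x hj]

theorem triFor_instAt (ihH : ∀ K ∈ H.options x, ∀ q : (compound B S).Position, Preserves x K q)
    (ihq : ∀ c, q c = none → Preserves x H (q.color c !x))
    (h : TriFor x (board q).game H.toGame) : TriFor x q.game (instAt q H) := by
  obtain ⟨K, hK, hle⟩ | ⟨K, hK, hle⟩ | ⟨o, o', hq, hH⟩ := h.cases
  · obtain ⟨c, hc, rfl⟩ := Position.isOption_game_iff.1 hK
    rw [← board_color_inl] at hle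
    have := (ihq (.inl c) hc).1 hle
    rw [instAt_color_inl] at this
    exact .of_isOption_not (Position.isOption_color (p := q) hc (!x)) this
  · cases H with
    | atom o => exact (not_isOption_atom (Template.toGame_atom o ▸ hK)).elim
    | comp m n L R =>
      obtain ⟨K, hK', rfl⟩ := Template.exists_mem_options hK
      exact .of_isOption (Template.isOption_inst_of_mem hK' _) ((ihH K hK' q).1 hle)
  · obtain ⟨c, hc⟩ | ⟨w, hw⟩ := (board q).exists_eq_none_or_eq_some
    · exact ((Position.isOption_color hc x).not_isAtomic ⟨o, hq⟩).elim
    cases H with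
    | atom o =>
      rw [hw, Position.game_some, Template.toGame_atom] at h
      exact Position.triFor_of_game_leFor
        (((equivalent_of_board_eq_some hw).leFor x).trans (Template.leFor_inst_atom h _))
    | comp m n L R => exact (Template.not_isAtomic_inst_comp _ ⟨o', hH⟩).elim

theorem preserves_of (ihH : ∀ y, ∀ K ∈ H.options y, ∀ q : (compound B S).Position, Preserves x K q)
    (ihq : ∀ c y, q c = none → Preserves x H (q.color c y))
    (hpart : LEFor x (board q).game H.toGame → ∀ c, q (.inr c) = none →
      TriFor x (q.color (.inr c) x).game (instAt q H))
    (hinst : LEFor x (board q).game H.toGame → ∀ K, IsOption (!x) K (instAt q H) →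
      TriFor x q.game K) : Preserves x H q := by
  have tri := triFor_instAt (ihH x) fun c hc => ihq c _ hc
  refine ⟨fun h => leFor_iff.2 ⟨fun K hK => ?_, hinst h, fun hA => tri (h.tri_of_isAtomic ?_)⟩, tri⟩
  · obtain ⟨c | c, hc, rfl⟩ := Position.isOption_game_iff.1 hK
    · have := (ihq (.inl c) x hc).2
      rw [board_color_inl, instAt_color_inl] at this
      exact this (h.tri_of_isOption (Position.isOption_color hc x))
    · exact hpart h c hc
  · refine hA.imp (fun hq => ?_) fun hi => ?_
    · obtain ⟨c, hc⟩ | ⟨w, hw⟩ := (board q).exists_eq_none_or_eq_some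
      · exact ((Position.isOption_color (p := q) hc x).not_isAtomic hq).elim
      · exact ⟨_, hw ▸ Position.game_some w⟩
    · cases H with
      | atom o => exact ⟨o, Template.toGame_atom o⟩
      | comp m n L R => exact (Template.not_isAtomic_inst_comp _ hi).elim

theorem preserves_atom (x : Bool) (o : Outcome.{u} k) (q : (compound B S).Position) :
    Preserves x (.atom o) q := by
  induction q using Position.color_induction with
  | h q ihq =>
  have leFor_color_inr (h : LEFor x (board q).game (Template.atom o).toGame)
      (c : Σ i, (S i).carrier) (hc : q (.inr c) = none) (y : Bool) :
      LEFor x (q.color (.inr c) y).game (instAt (q.color (.inr c) y) (.atom o)) :=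
    (ihq (.inr c) y hc).1 (by rwa [board_color_inr])
  refine preserves_of (fun y K hK => by cases y <;> cases hK) ihq ?_ ?_
  · rintro h ⟨i, c⟩ hc
    have hle := leFor_color_inr h ⟨i, c⟩ hc x
    by_cases hi : o = .label i
    · subst hi
      refine .of_isOption (Position.isOption_color (p := part q i) hc x) ?_
      rwa [← part_color_inr_same]
    · rw [instAt_color_inr (H := .atom o) hi] at hle
      exact Position.triFor_of_game_leFor hle
  · intro h K hK
    cases o with
    | label i =>
      obtain ⟨c, hc, rfl⟩ := Position.isOption_game_iff.1 hK
      rw [← part_color_inr_same]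
      exact .of_isOption_not (Position.isOption_color (p := q) hc _)
        (leFor_color_inr h ⟨i, c⟩ hc _)
    | _ => exact (not_isOption_atom hK).elim

theorem preserves (x : Bool) (hH : Template.Insulated.{u, v} H) (q : (compound B S).Position) :
    Preserves x H q := by
  induction hH generalizing q with
  | atom o => exact preserves_atom x o q
  | @comp m n L R _ escape ihH =>
  induction q using Position.color_induction with
  | h q ihq =>
  refine preserves_of ihH ihq ?_ ?_
  · rintro h ⟨i, c⟩ -
    obtain ⟨y, K, hK, hKi, hle⟩ := escape i
    have hpre := ihH y K hK (q.color (.inr ⟨i, c⟩) x)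
    rw [Preserves, board_color_inr, instAt_color_inr hKi] at hpre
    by_cases hy : y = x
    · subst hy
      exact .of_isOption (Template.isOption_inst_of_mem hK _) (hpre.1 (h.trans (hle _ _)))
    · obtain rfl := Bool.eq_not_iff.2 hy
      exact (hpre.2 (h.tri_of_isOption_not (Template.isOption_inst_of_mem hK _))).trans_le
        (leFor_not.1 (hle _ _))
  · intro h K hK
    obtain ⟨K, hK', rfl⟩ := Template.exists_mem_options hK
    exact (ihH _ K hK' q).2 (h.tri_of_isOption_not (Template.isOption_inst_of_mem hK' _))

end MonotoneSetColoringGame.compound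

namespace CGame

variable {k : ℕ} {A : Type u} [PartialOrder A]

theorem IsRealizable.of_equivalent {G H : CGame.{u, v} A} (hH : H.IsRealizable)
    (h : Equivalent G H) : G.IsRealizable :=
  hH.imp fun _ hS => h.trans hS

theorem IsRealizable.inst [BoundedOrder A] {H : Template.{u} k} (hH : Template.Insulated.{u, v} H)
    (hreal : IsRealizable.{u, v} H.toGame) {σ : Fin k → CGame.{u, v} A}
    (hσ : ∀ i, (σ i).IsRealizable) : (H.inst σ).IsRealizable := by
  obtain ⟨B, hB⟩ := hreal
  choose S hS using hσ
  refine ⟨MonotoneSetColoringGame.compound B S, equivalent_of_leFor fun x => ?_⟩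
  have hσ : LEFor x (H.inst σ) (H.inst fun i => (S i).game) :=
    Template.inst_mono (fun i => (hS i).leFor x) H
  have hpre := MonotoneSetColoringGame.compound.preserves (B := B) (S := S) (!x) hH fun _ => none
  exact hσ.trans (leFor_not.1 (hpre.1 (leFor_not.2 (hB.leFor x))))

end CGame

namespace Outcome

variable {k n : ℕ}

instance : SemilatticeSup (Outcome.{u} k) where
  sup o o' := if o ≤ o' then o' else if o' ≤ o then o else top
  le_sup_left o o' := by
    split_ifs with h h'
    exacts [h, le_rfl, le_top]
  le_sup_right o o' := by
    split_ifs with h h'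
    exacts [le_rfl, h', le_top]
  sup_le o o' o'' h h' := by
    split_ifs with h₁ h₂
    · exact h'
    · exact h
    · rw [le_def] at h h' h₁ h₂
      grind

/-- The outcome as seen by the player `x`: the right player exchanges `⊥` and `⊤`. -/
def orient : Bool → Outcome.{u} k → Outcome.{u} k
  | true, o => o
  | false, o => o.elim top bot label

theorem antitone_orient_false : Antitone (orient.{u} (k := k) false) := by
  rintro o o' (rfl | rfl | rfl)
  exacts [le_top, bot_le, le_rfl]

/-- A rule `r` says that owning all cells in `r.1` is worth the outcome `r.2`. This is what a
player gets who owns the cells in `w`. -/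
def claim (rules : List (List (Fin n) × Outcome.{u} k)) (w : Fin n → Bool) : Outcome.{u} k :=
  rules.foldr (fun r o => if r.1.all w then r.2 ⊔ o else o) ⊥

theorem monotone_claim (rules : List (List (Fin n) × Outcome.{u} k)) : Monotone (claim rules) := by
  intro w w' h
  induction rules with
  | nil => exact le_rfl
  | cons r rules ih =>
    have hr : r.1.all w → r.1.all w' := by
      simp only [List.all_eq_true]
      exact fun hw c hc => Bool.le_iff_imp.1 (h c) (hw c hc)
    change (if r.1.all w then _ else _) ≤ (if r.1.all w' then _ else _)
    split_ifs with hw hw' hw'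
    · exact sup_le_sup_left ih _
    · exact (hw' (hr hw)).elim
    · exact le_sup_of_le_right ih
    · exact ih

/-- The payoff of a board with rules for the player `x`. -/
def payoff (x : Bool) (rules : List (List (Fin n) × Outcome.{u} k)) :
    (Fin n → Bool) →o Outcome.{u} k where
  toFun w := orient x (claim rules fun c => w c == x)
  monotone' w w' h := by
    cases x
    · refine antitone_orient_false (monotone_claim rules fun c => ?_)
      rw [Bool.le_iff_imp, beq_iff_eq, beq_iff_eq, ← Bool.not_eq_true, ← Bool.not_eq_true]
      exact mt (Bool.le_iff_imp.1 (h c))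
    · refine monotone_claim rules fun c => ?_
      simpa using h c

end Outcome

namespace MonotoneSetColoringGame

open CGame

/-- The game with payoff function `π` and numbered cells. -/
@[reducible] def ofFin {A : Type u} [PartialOrder A] {n : ℕ} (π : (Fin n → Bool) →o A) :
    MonotoneSetColoringGame.{u, v} A where
  carrier := ULift (Fin n)
  finite_carrier := inferInstance
  payoff := ⟨fun w => π fun c => w ⟨c⟩, fun _ _ h => π.monotone fun _ => h _⟩

namespace ofFin

variable {n k : ℕ} (π : (Fin n → Bool) →o Outcome.{u} k) {x : Bool} {p q : List (Option Bool)}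
  {H : Template.{u} k}

/-- The position given by the list of the `n` cells. -/
def position (p : List (Option Bool)) : (ofFin.{u, v} π).Position := fun c => p.getD c.down none

/-- The positions, as lists of cells, that the player `x` can move to. -/
def moves (x : Bool) : List (Option Bool) → List (List (Option Bool))
  | [] => []
  | none :: p => (some x :: p) :: (moves x p).map (none :: ·)
  | some y :: p => (moves x p).map (some y :: ·)

theorem mem_moves : q ∈ moves x p ↔ ∃ c, p[c]? = some none ∧ q = p.set c (some x) := by
  induction p generalizing q with
  | nil => simp [moves]
  | cons o p ih =>
    have hmap : q ∈ (moves x p).map (o :: ·) ↔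
        ∃ c, p[c]? = some none ∧ q = o :: p.set c (some x) := by
      simp only [List.mem_map, ih]
      grind
    rw [← Nat.or_exists_add_one]
    cases o
    · simp [moves, hmap]
    · simp [moves, hmap]

theorem position_set {c : ℕ} (hc : c < n) (hp : p.length = n) :
    position π (p.set c (some x)) = (position π p).color ⟨c, hc⟩ x := by
  funext ⟨d⟩
  by_cases h : d = ⟨c, hc⟩
  · subst h
    rw [Position.color_same]
    simp [position, hp, hc]
  · rw [Position.color_of_ne _ (by simpa using h)]
    have : c ≠ d := fun e => h (Fin.ext e.symm)
    simp [position, this]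

theorem isOption_position_iff (hp : p.length = n) {K : CGame.{u, v} (Outcome.{u} k)} :
    IsOption x K (position π p).game ↔ ∃ q ∈ moves x p, K = (position π q).game := by
  rw [Position.isOption_game_iff]
  constructor
  · rintro ⟨⟨c⟩, hc, rfl⟩
    refine ⟨_, mem_moves.2 ⟨c, ?_, rfl⟩, by rw [position_set π c.2 hp]⟩
    simpa [position, hp] using hc
  · rintro ⟨q, hq, rfl⟩
    obtain ⟨c, hc, rfl⟩ := mem_moves.1 hq
    have hcn : c < n := hp ▸ (List.getElem?_eq_some_iff.1 hc).1
    exact ⟨⟨c, hcn⟩, by simp [position, hc], by rw [position_set π hcn hp]⟩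

theorem length_eq_of_mem_moves (hq : q ∈ moves x p) : q.length = p.length := by
  obtain ⟨c, -, rfl⟩ := mem_moves.1 hq
  exact List.length_set

/-- Decides whether `p ⊲ H` for the player `x`, given a test for `≤` after a move. -/
def triCheck (x : Bool) (le : List (Option Bool) → Template.{u} k → Bool)
    (p : List (Option Bool)) (H : Template.{u} k) : Bool :=
  (moves (!x) p).any (le · H) || (H.options x).any (le p ·) ||
    match H with
    | .atom o => !p.contains none &&
        let o' := π fun c => (p.getD c none).getD false
        if x then o' ≤ o else o ≤ o'
    | .comp .. => false

/-- Decides whether `p ≤ H` for the player `x`, provided that the first argument exceeds the number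
of moves that can be made in `p` and `H` together. The clause of `≤` for atomic games is skipped if
`p` has an empty cell: it then follows from the first one, as coloring a cell never hurts. -/
def leCheck (x : Bool) : ℕ → List (Option Bool) → Template.{u} k → Bool
  | 0, _, _ => false
  | fuel + 1, p, H => (moves x p).all (triCheck π x (leCheck x fuel) · H) &&
      (H.options !x).all (triCheck π x (leCheck x fuel) p ·) &&
      (p.contains none || triCheck π x (leCheck x fuel) p H)

theorem game_position (hp : p.length = n) (h : none ∉ p) :
    (position π p).game = atom (π fun c => (p.getD c none).getD false) := by
  have : position π p = fun c => some ((p.getD c.down none).getD false) := by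
    funext ⟨c⟩
    have hc : c.1 < p.length := hp ▸ c.2
    have : p[c.1] ≠ none := fun e => h (e ▸ List.getElem_mem hc)
    obtain ⟨y, hy⟩ := Option.ne_none_iff_exists'.1 this
    simp [position, hc, hy]
  rw [this, Position.game_some]
  rfl

theorem triFor_of_triCheck {le : List (Option Bool) → Template.{u} k → Bool}
    (hle : ∀ p H, p.length = n → le p H → LEFor x (position.{u, v} π p).game H.toGame)
    (hp : p.length = n) (h : triCheck π x le p H) :
    TriFor x (position.{u, v} π p).game H.toGame := by
  simp only [triCheck, Bool.or_eq_true, List.any_eq_true] at h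
  obtain (⟨q, hq, h⟩ | ⟨K, hK, h⟩) | h := h
  · exact .of_isOption_not ((isOption_position_iff π hp).2 ⟨q, hq, rfl⟩)
      (hle q H (length_eq_of_mem_moves hq ▸ hp) h)
  · exact .of_isOption (Template.isOption_inst_of_mem hK _) (hle p K hp h)
  · cases H with
    | comp => cases h
    | atom o =>
      simp only [Bool.and_eq_true, Bool.not_eq_true', List.contains_eq_mem, decide_eq_false_iff_not]
        at h
      rw [game_position π hp h.1, Template.toGame_atom]
      cases x <;> exact tri_atom_iff.2 (by simpa using h.2)

theorem leFor_of_leCheck {fuel : ℕ} (hp : p.length = n) (h : leCheck π x fuel p H) :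
    LEFor x (position.{u, v} π p).game H.toGame := by
  induction fuel generalizing p H with
  | zero => cases h
  | succ fuel ih =>
    have tri {p : List (Option Bool)} {H : Template.{u} k} (hp : p.length = n)
        (h : triCheck π x (leCheck π x fuel) p H) : TriFor x (position.{u, v} π p).game H.toGame :=
      triFor_of_triCheck π (fun p H hp h => ih hp h) hp h
    simp only [leCheck, Bool.and_eq_true, List.all_eq_true, Bool.or_eq_true] at h
    obtain ⟨⟨hmoves, hoptions⟩, hfull⟩ := h
    have hmoves' {q} (hq : q ∈ moves x p) : TriFor x (position.{u, v} π q).game H.toGame :=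
      tri (length_eq_of_mem_moves hq ▸ hp) (hmoves q hq)
    refine leFor_iff.2 ⟨fun K hK => ?_, fun K hK => ?_, fun _ => ?_⟩
    · obtain ⟨q, hq, rfl⟩ := (isOption_position_iff π hp).1 hK
      exact hmoves' hq
    · cases H with
      | atom o => exact (not_isOption_atom (Template.toGame_atom o ▸ hK)).elim
      | comp m n L R =>
        obtain ⟨K, hK', rfl⟩ := Template.exists_mem_options hK
        exact tri hp (hoptions K hK')
    · obtain hfull | hfull := hfull
      · obtain ⟨c, hcp, hc⟩ := List.mem_iff_getElem.1 (List.contains_iff_mem.1 hfull)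
        have hle := Position.leFor_color (p := position.{u, v} π p) (c := ⟨c, hp ▸ hcp⟩)
          (by simp [position, hcp, hc]) x
        rw [← position_set π _ hp] at hle
        exact hle.trans_tri (hmoves' (mem_moves.2 ⟨c, by simp [hcp, hc], rfl⟩))
      · exact tri hp hfull

theorem isRealizable_of_leCheck {fuel : ℕ}
    (h : ∀ x, leCheck π x fuel (List.replicate n none) H) : IsRealizable.{u, v} H.toGame := by
  have hp : position.{u, v} π (List.replicate n none) = fun _ => none := by
    funext c
    simp [position]
  have hle (x : Bool) : LEFor x (game (ofFin.{u, v} π)) H.toGame := by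
    rw [game, ← hp]
    exact leFor_of_leCheck π List.length_replicate (h x)
  exact ⟨ofFin π, (equivalent_of_leFor hle).symm⟩

end ofFin

end MonotoneSetColoringGame

namespace Template

open CGame MonotoneSetColoringGame

variable {k : ℕ} {x : Bool}

section Node

variable {m n : ℕ} {L : Fin (m + 1) → Template.{u} k} {R : Fin (n + 1) → Template.{u} k}

/-- The template with options `L` for the player `x` and options `R` for the opponent. -/
def node (x : Bool) (L : Fin (m + 1) → Template.{u} k) (R : Fin (n + 1) → Template.{u} k) :
    Template.{u} k :=
  match x with
  | true => comp m n L R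
  | false => comp n m R L

theorem mem_options_node (i : Fin (m + 1)) : L i ∈ (node x L R).options x := by
  cases x <;> exact List.mem_ofFn.2 ⟨i, rfl⟩

theorem mem_options_node_not (j : Fin (n + 1)) : R j ∈ (node x L R).options !x := by
  cases x <;> exact List.mem_ofFn.2 ⟨j, rfl⟩

variable {A : Type u} {K : CGame.{u, v} A} [PartialOrder A] [BoundedOrder A]
  {σ : Fin k → CGame.{u, v} A}

theorem isOption_inst_node : IsOption x K ((node x L R).inst σ) ↔ ∃ i, K = (L i).inst σ := by
  cases x <;> exact ⟨fun ⟨i, h⟩ => ⟨i.down, h⟩, fun ⟨i, h⟩ => ⟨⟨i⟩, h⟩⟩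

theorem isOption_not_inst_node :
    IsOption (!x) K ((node x L R).inst σ) ↔ ∃ j, K = (R j).inst σ := by
  cases x <;> exact ⟨fun ⟨i, h⟩ => ⟨i.down, h⟩, fun ⟨i, h⟩ => ⟨⟨i⟩, h⟩⟩

theorem insulated_node (hL : ∀ i, Insulated.{u, v} (L i)) (hR : ∀ j, Insulated.{u, v} (R j))
    (escape : ∀ i, ∃ y, ∃ K ∈ (node x L R).options y, K.Avoids i ∧
      ∀ (A : Type u) [PartialOrder A] [BoundedOrder A] (σ : Fin k → CGame.{u, v} A),
        LEFor y ((node x L R).inst σ) (K.inst σ)) :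
    Insulated.{u, v} (node x L R) := by
  cases x <;> refine .comp (fun y K hK => ?_) escape <;>
    cases y <;> obtain ⟨i, rfl⟩ := List.mem_ofFn.1 hK
  exacts [hL i, hR i, hR i, hL i]

end Node

theorem avoids_best (i : Fin k) : (atom (best x) : Template.{u} k).Avoids i := by
  cases x <;> rintro ⟨⟩

section Gadgets

variable {A : Type u} [PartialOrder A] [BoundedOrder A] {σ : Fin k → CGame.{u, v} A}
  {H K : CGame.{u, v} A}

theorem inst_best : (atom (best x)).inst σ = CGame.atom (best x) := by cases x <;> rfl

/-- The player `x` threatens to win, to which the opponent must reply by moving to the `i`-th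
game. -/
def threat (x : Bool) (i : Fin k) : Template.{u} k := node x ![atom (best x)] ![atom (.label i)]

theorem isOption_best_threat (x : Bool) (i : Fin k) :
    IsOption x (CGame.atom (best x)) ((threat x i).inst σ) :=
  isOption_inst_node.2 ⟨0, inst_best.symm⟩

theorem isOption_not_threat {i : Fin k} :
    IsOption (!x) K ((threat x i).inst σ) ↔ K = σ i :=
  isOption_not_inst_node.trans ⟨fun ⟨0, h⟩ => h, fun h => ⟨0, h⟩⟩

theorem leFor_threat {i : Fin k} (h : TriFor x K (σ i)) : LEFor x K ((threat x i).inst σ) := by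
  have tri (K : CGame.{u, v} A) : TriFor x K ((threat x i).inst σ) :=
    .of_isOption (isOption_best_threat x i) (leFor_atom_best x K)
  refine leFor_iff.2 ⟨fun K' _ => tri K', fun K' hK' => ?_, fun _ => tri K⟩
  rwa [isOption_not_threat.1 hK']

theorem triFor_threat {i : Fin k} (h : LEFor x (σ i) H) : TriFor x ((threat x i).inst σ) H :=
  .of_isOption_not (isOption_not_threat.2 rfl) h

theorem avoids_threat {i j : Fin k} (h : i ≠ j) : (threat.{u} x i).Avoids j := by
  have hi : (atom (.label i) : Template.{u} k).Avoids j := by simpa [Avoids] using h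
  cases x
  exacts [⟨fun 0 => hi, fun 0 => avoids_best j⟩, ⟨fun 0 => avoids_best j, fun 0 => hi⟩]

theorem insulated_threat (x : Bool) (i : Fin k) : Insulated.{u, v} (threat.{u} x i) :=
  insulated_node (fun 0 => .atom _) (fun 0 => .atom _) fun i =>
    ⟨x, _, mem_options_node 0, avoids_best i,
      fun _ _ _ σ => inst_best (σ := σ) ▸ leFor_atom_best x _⟩

/-- The player `x` may choose between two games, but loses if the opponent moves first. -/
def choice (x : Bool) : Template.{u} 2 :=
  node x ![atom (.label 0), atom (.label 1)] ![atom (best !x)]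

theorem isOption_not_choice (σ : Fin 2 → CGame.{u, v} A) :
    IsOption (!x) (CGame.atom (best !x)) ((choice x).inst σ) :=
  isOption_not_inst_node.2 ⟨0, inst_best.symm⟩

theorem leFor_choice_iff {σ : Fin 2 → CGame.{u, v} A} :
    LEFor x ((choice x).inst σ) H ↔ ∀ i, TriFor x (σ i) H := by
  constructor
  · refine fun h i => h.tri_of_isOption (isOption_inst_node.2 ⟨i, ?_⟩)
    fin_cases i <;> rfl
  · have tri (K : CGame.{u, v} A) : TriFor x ((choice x).inst σ) K :=
      .of_isOption_not (isOption_not_choice σ) (leFor_atom_best_not x K)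
    refine fun h => leFor_iff.2 ⟨fun K hK => ?_, fun K _ => tri K, fun _ => tri H⟩
    obtain ⟨i, rfl⟩ := isOption_inst_node.1 hK
    fin_cases i
    exacts [h 0, h 1]

theorem insulated_choice (x : Bool) : Insulated.{u, v} (choice.{u} x) :=
  insulated_node (fun i => by fin_cases i <;> exact .atom _) (fun 0 => .atom _) fun i =>
    ⟨!x, _, mem_options_node_not 0, avoids_best i,
      fun _ _ _ σ => inst_best (σ := σ) ▸ leFor_atom_best (!x) _⟩

/-- The player `x` may choose between the first two games, and the opponent may make a threat with
any of the three games. It is used with two equal games in the first two places: the repetition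
makes sure that for every label there is a threat by another label that is harmless for `x`. -/
def arena (x : Bool) : Template.{u} 3 :=
  node x ![atom (.label 0), atom (.label 1)] ![threat (!x) 0, threat (!x) 1, threat (!x) 2]

theorem isOption_arena {σ : Fin 3 → CGame.{u, v} A} :
    IsOption x K ((arena x).inst σ) ↔ K = σ 0 ∨ K = σ 1 := by
  refine isOption_inst_node.trans ⟨?_, ?_⟩
  · rintro ⟨i, rfl⟩
    fin_cases i
    exacts [.inl rfl, .inr rfl]
  · rintro (rfl | rfl)
    exacts [⟨0, rfl⟩, ⟨1, rfl⟩]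

theorem threat_mem_options_arena (x : Bool) (i : Fin 3) :
    threat.{u} (!x) i ∈ (arena x).options !x := by
  fin_cases i
  exacts [mem_options_node_not 0, mem_options_node_not 1, mem_options_node_not 2]

theorem isOption_not_arena {σ : Fin 3 → CGame.{u, v} A} :
    IsOption (!x) K ((arena x).inst σ) ↔ ∃ i, K = (threat (!x) i).inst σ := by
  refine isOption_not_inst_node.trans ⟨?_, ?_⟩
  · rintro ⟨i, rfl⟩
    fin_cases i
    exacts [⟨0, rfl⟩, ⟨1, rfl⟩, ⟨2, rfl⟩]
  · rintro ⟨i, rfl⟩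
    fin_cases i
    exacts [⟨0, rfl⟩, ⟨1, rfl⟩, ⟨2, rfl⟩]

theorem insulated_arena (x : Bool) : Insulated.{u, v} (arena.{u} x) := by
  refine insulated_node (fun i => ?_) (fun i => ?_) fun i => ?_
  · fin_cases i <;> exact .atom _
  · fin_cases i <;> exact insulated_threat _ _
  · obtain ⟨j, hj, hji⟩ : ∃ j : Fin 3, (j = 0 ∨ j = 1) ∧ j ≠ i := by decide +revert
    refine ⟨!x, _, threat_mem_options_arena x j, ?_, fun _ _ _ σ => leFor_threat ?_⟩
    · exact avoids_threat hji
    · refine triFor_not.2 (triFor_of_isOption (isOption_arena.2 ?_))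
      exact hj.imp (congrArg σ) (congrArg σ)

end Gadgets

open Outcome in
theorem isRealizable_threat (x : Bool) : IsRealizable.{u, v} (threat.{u} x (0 : Fin 1)).toGame :=
  ofFin.isRealizable_of_leCheck (fuel := 4)
    (payoff x [([], .label (0 : Fin 1)), ([(0 : Fin 1)], .top)])
    (by decide +kernel +revert)

open Outcome in
theorem isRealizable_choice (x : Bool) : IsRealizable.{u, v} (choice.{u} x).toGame :=
  ofFin.isRealizable_of_leCheck (fuel := 6)
    (payoff x [([(0 : Fin 3), 2], .label (0 : Fin 2)), ([0, 1], .label 1), ([1, 2], .top)])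
    (by decide +kernel +revert)

open Outcome in
theorem isRealizable_arena (x : Bool) : IsRealizable.{u, v} (arena.{u} x).toGame :=
  ofFin.isRealizable_of_leCheck (fuel := 10) (payoff x
    [([(0 : Fin 6), 2, 4], .top), ([1, 2, 5], .top), ([0, 1, 2], .top), ([0, 3, 4], .top),
      ([1, 2, 4], .label (0 : Fin 3)), ([3, 4, 5], .label 0), ([2, 3, 5], .label 0),
      ([1, 3, 5], .label 0), ([1, 3, 4], .label 0), ([0, 1, 3], .label 0), ([0, 1, 4], .label 1),
      ([0, 2, 3], .label 1), ([0, 2, 5], .label 2)])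
    (by decide +kernel +revert)

end Template

namespace CGame

open Template

variable {A : Type u} {G K X Y : CGame.{u, v} A} {x : Bool}

theorem IsFinite.of_isPosition (hG : G.IsFinite) (h : IsPosition G K) : K.IsFinite :=
  hG.imp fun _ => And.imp_right fun hs _ hK => hs _ (h.trans hK)

variable [PartialOrder A]

theorem isRealizable_atom (a : A) : IsRealizable.{u, v} (atom a) := by
  refine ⟨.constant a, ?_⟩
  rw [MonotoneSetColoringGame.game, MonotoneSetColoringGame.game_constant]
  exact equivalent_of_leFor fun x => leFor_refl x _

/-- `X` plays the role of the set of options of `G` for the player `x`: it is, for this player, the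
least game with `K ⊲ X` for all of these options `K`. -/
def Gathers (x : Bool) (G X : CGame.{u, v} A) : Prop :=
  ∀ H, LEFor x X H ↔ ∀ K, IsOption x K G → TriFor x K H

theorem Gathers.leFor (h : Gathers x G X) : LEFor x X G := (h G).2 fun _ => triFor_of_isOption

theorem Gathers.triFor (h : Gathers x G X) (hK : IsOption x K G) : TriFor x K X :=
  (h X).1 (leFor_refl x X) K hK

theorem IsPassable.of_isPosition (hG : G.IsPassable) (h : IsPosition G K) : K.IsPassable :=
  fun _ hK => hG _ (h.trans hK)

variable [BoundedOrder A]

theorem IsRealizable.threat (x : Bool) (hX : X.IsRealizable) :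
    ((Template.threat x (0 : Fin 1)).inst fun _ => X).IsRealizable :=
  .inst (insulated_threat x 0) (isRealizable_threat x) fun _ => hX

theorem exists_isRealizable_leFor_iff_forall_mem (x : Bool) {t : Set (CGame.{u, v} A)}
    (ht : t.Finite) (h : ∀ K ∈ t, K.IsRealizable) :
    ∃ X : CGame.{u, v} A, X.IsRealizable ∧ ∀ H, LEFor x X H ↔ ∀ K ∈ t, TriFor x K H := by
  induction t, ht using Set.Finite.induction_on with
  | empty => exact ⟨_, isRealizable_atom (best !x), fun H => by simp [leFor_atom_best_not]⟩
  | @insert K t _ _ ih =>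
    obtain ⟨X, hX, hXt⟩ := ih fun K hK => h K (.inr hK)
    refine ⟨(choice x).inst ![K, (threat x (0 : Fin 1)).inst fun _ => X],
      .inst (insulated_choice x) (isRealizable_choice x) ?_, fun H => ?_⟩
    · exact Fin.forall_fin_two.2 ⟨h K (.inl rfl), hX.threat x⟩
    · rw [leFor_choice_iff, Fin.forall_fin_two, Set.forall_mem_insert]
      refine and_congr_right fun _ => ⟨fun hXH K' hK' => ?_, fun hH => triFor_threat ((hXt H).2 hH)⟩
      exact (leFor_threat ((hXt X).1 (leFor_refl x X) K' hK')).trans_tri hXH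

theorem IsFinite.exists_isRealizable_gathers (hG : G.IsFinite)
    (h : ∀ K, IsOption x K G → K.IsRealizable) :
    ∃ X : CGame.{u, v} A, X.IsRealizable ∧ Gathers x G X := by
  obtain ⟨s, hs, hsG⟩ := hG
  have ht : {K' ∈ s | ∃ K, IsOption x K G ∧ Identical K K'}.Finite := hs.subset (Set.sep_subset _ _)
  obtain ⟨X, hX, hXt⟩ := exists_isRealizable_leFor_iff_forall_mem x ht (by
    rintro K' ⟨-, K, hK, hKK'⟩
    exact (h K hK).of_equivalent hKK'.symm.equivalent)
  refine ⟨X, hX, fun H => (hXt H).trans ⟨fun hH K hK => ?_, ?_⟩⟩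
  · obtain ⟨K', hK', hKK'⟩ := hsG K hK.isPosition
    exact (hKK'.leFor x).trans_tri (hH K' ⟨hK', K, hK, hKK'⟩)
  · rintro hH K' ⟨-, K, hK, hKK'⟩
    exact (hKK'.symm.leFor x).trans_tri (hH K hK)

theorem equivalent_inst_arena {S : CGame.{u, v} A} (hX : Gathers x G X) (hY : Gathers (!x) G Y)
    (hS : S = (threat x (0 : Fin 1)).inst fun _ => X) (hK : IsOption x K G) (hGK : LEFor x G K) :
    Equivalent G ((arena x).inst ![S, S, Y]) := by
  have hGS : LEFor x G S := hS ▸ leFor_threat (hGK.trans_tri (hX.triFor hK))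
  have hGY : LEFor x G Y := leFor_not.1 hY.leFor
  have composite : ¬ (IsAtomic G ∨ IsAtomic ((arena x).inst ![S, S, Y])) :=
    not_or.2 ⟨hK.not_isAtomic, (isOption_arena.2 (.inl rfl)).not_isAtomic⟩
  refine LEFor.equivalent (x := x)
    (leFor_iff.2 ⟨fun K hK => ?_, fun K hK => ?_, fun hA => (composite hA).elim⟩)
    (leFor_iff.2 ⟨fun K hK => ?_, fun K hK => ?_, fun hA => (composite hA.symm).elim⟩)
  · exact .of_isOption (isOption_arena.2 (.inl rfl)) (hS ▸ leFor_threat (hX.triFor hK))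
  · obtain ⟨i, rfl⟩ := isOption_not_arena.1 hK
    refine triFor_not.1 (triFor_threat (leFor_not.2 ?_))
    fin_cases i
    exacts [hGS, hGS, hGY]
  · obtain rfl : K = S := (isOption_arena.1 hK).elim id id
    exact hS ▸ triFor_threat hX.leFor
  · exact .of_isOption_not (isOption_not_arena.2 ⟨2, rfl⟩)
      (leFor_not.1 (leFor_threat (hY.triFor hK)))

theorem IsFinite.isRealizable_of_leFor_option (hG : G.IsFinite)
    (h : ∀ y K, IsOption y K G → K.IsRealizable) (hK : IsOption x K G) (hGK : LEFor x G K) :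
    G.IsRealizable := by
  obtain ⟨X, hX, hXG⟩ := hG.exists_isRealizable_gathers (h x)
  obtain ⟨Y, hY, hYG⟩ := hG.exists_isRealizable_gathers (h !x)
  refine IsRealizable.of_equivalent ?_ (equivalent_inst_arena hXG hYG rfl hK hGK)
  refine .inst (insulated_arena x) (isRealizable_arena x) fun i => ?_
  fin_cases i
  exacts [hX.threat x, hX.threat x, hY]

end CGame

theorem theorem3p2 {A : Type u} [PartialOrder A] [BoundedOrder A] (G : CGame.{u, v} A)
    (hfin : G.IsFinite) (hpass : G.IsPassable) : G.IsRealizable := by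
  induction G using CGame.option_induction with
  | h G ih =>
    have hoption (x : Bool) (K : CGame.{u, v} A) (hK : CGame.IsOption x K G) : K.IsRealizable :=
      ih x K hK (hfin.of_isPosition hK.isPosition) (hpass.of_isPosition hK.isPosition)
    obtain ⟨a, rfl⟩ | ⟨K, hK, hle⟩ | ⟨K, hK, hle⟩ := hpass G .refl
    · exact CGame.isRealizable_atom a
    · exact hfin.isRealizable_of_leFor_option (x := true) hoption hK hle
    · exact hfin.isRealizable_of_leFor_option (x := false) hoption hK hle
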